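/- Let $q$ be a prime power, $l\ge 1$ and $t=q^l$, and assume $t>2q-3$ (that is, $l\ge 2$, or $q=2$). Let $G_6(x)=x^{t+1}+1$ and $L_6=\{\alpha\in GF(t^2): G_6(\alpha)\neq 0\}$, and let $\Gamma_6^{(q)}=\Gamma(L_6,G_6^q)$ be the $q$-ary Goppa code $$\Big\{(c_\alpha)_{\alpha\in L_6}\in GF(q)^{L_6}:\ \sum_{\alpha\in L_6}\frac{c_\alpha}{x-\alpha}\equiv 0 \pmod{G_6(x)^q}\Big\},$$ with dimension $k_6^{(q)}$ over $GF(q)$. For $1\le j\le q-1$ let $h_j$ be the matrix over $GF(t^2)$ with rows $$\rho_{j,a}=\Big(\frac{\alpha^a}{(\alpha^{t+1}+1)^j}\Big)_{\alpha\in L_6},\qquad a=0,1,\dots,t.$$ Fix any basis of $GF(t^2)=GF(q^{2l})$ over $GF(q)$; expanding the entries in this basis, each row over $GF(t^2)$ becomes $2l$ $q$-ary rows. Then: 1. The $q$-ary matrix $H$ with blocks $h_1,\dots,h_{q-1}$ (expanded in this way) is a parity-check matrix of $\Gamma_6^{(q)}$, i.e. $\Gamma_6^{(q)}=\{c\in GF(q)^{L_6}: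 Hc=0\}$. 2. For each $f=1,\dots,q-1$, the $q$-ary rows of the row $\rho_{1,\,f t/q+1}$ of $h_1$ are $GF(q)$-linear combinations of the $q$-ary rows of the row $\rho_{1,\,t-f t/q}$ of $h_1$ and of the rows $\rho_{j,\,q-f}$ of $h_j$, $q-f\le j\le q-1$. 3. The rows $\rho_{1,\,ft/q+1}$, $f=1,\dots,q-1$, account for exactly $(q-1)2l$ $q$-ary rows of $H$; after all of them are deleted from $H$, the remaining matrix is still a parity-check matrix of $\Gamma_6^{(q)}$. 4. $$k_6^{(q)}\ \ge\ t^2-t-1-2l(q-1)\Big(t-\frac32-\frac{q-2}{2}\Big).$$ -/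

import Mathlib

open Polynomial

/-- The Goppa code `Γ(L, G)` over `F`, with locator set `L ⊆ K` (no element of which is a root of
`G`): all `c : L → F` with `∑_{α ∈ L} c_α / (x - α) ≡ 0 (mod G(x))`. -/
noncomputable def goppaCode (F : Type*) {K : Type*} [Field F] [Field K] [Algebra F K]
    (L : Finset K) (G : K[X]) : Submodule F (L → F) where
  carrier := {c | ∑ α : L, AdjoinRoot.of G (algebraMap F K (c α)) *
    Ring.inverse (AdjoinRoot.root G - AdjoinRoot.of G (α : K)) = 0}
  zero_mem' := by simp
  add_mem' := by
    intro c d hc hd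
    simp only [Set.mem_ofPred_eq] at hc hd ⊢
    simp only [Pi.add_apply, map_add, add_mul, Finset.sum_add_distrib, hc, hd, add_zero]
  smul_mem' := by
    intro a c hc
    simp only [Set.mem_ofPred_eq] at hc ⊢
    simp only [Pi.smul_apply, smul_eq_mul, map_mul, mul_assoc, ← Finset.mul_sum, hc, mul_zero]

/-- The separable polynomial `G₆(x) = x^(t+1) + 1`. -/
noncomputable def G6 (K : Type*) [Field K] (t : ℕ) : K[X] := X ^ (t + 1) + 1

open Classical in
/-- The locator set `L₆`: all elements of the (finite) field that are not roots of `G₆`. -/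
noncomputable def L6 (K : Type*) [Field K] [Fintype K] (t : ℕ) : Finset K :=
  Finset.univ.filter fun α => (G6 K t).eval α ≠ 0

/-- The code `Γ₆^(j) = Γ(L₆, G₆^j)`. -/
noncomputable def Gamma6 (F K : Type*) [Field F] [Field K] [Fintype K] [Algebra F K]
    (t j : ℕ) : Submodule F (L6 K t → F) :=
  goppaCode F (L6 K t) (G6 K t ^ j)

/-- The row of the block `h_j` with numerators `α^a`, namely `(α^a / (α^(t+1) + 1)^j)_{α ∈ L₆}`;
the block `h_j` consists of these rows for `a = 0, …, t`. -/
noncomputable def hRow (K : Type*) [Field K] [Fintype K] (t j a : ℕ) : L6 K t → K :=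
  fun α => (α : K) ^ a / ((α : K) ^ (t + 1) + 1) ^ j

/-- The `i`-th of the `F`-rows into which a row with entries in `K` is expanded by an
`F`-basis of `K`. -/
noncomputable def qaryRow {F K ι N : Type*} [Field F] [Field K] [Algebra F K]
    (b : Module.Basis ι F K) (r : N → K) (i : ι) : N → F :=
  fun α => b.repr (r α) i

/-- Labels of the `q`-ary rows of the matrix with blocks `h_1, …, h_{q-1}`: the label
`(j, a, i)` stands for the `i`-th `q`-ary row of the row with numerators `α^a` in the
block `h_{j+1}`. -/
abbrev RowIndex (q t m : ℕ) : Type := Fin (q - 1) × Fin (t + 1) × Fin m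

/-- The `q`-ary matrix with blocks `h_1, …, h_{q-1}`. -/
noncomputable def H6 {F K : Type*} [Field F] [Field K] [Fintype K] [Algebra F K]
    {m : ℕ} (b : Module.Basis (Fin m) F K) (q t : ℕ) :
    Matrix (RowIndex q t m) (L6 K t) F :=
  Matrix.of fun r => qaryRow b (hRow K t (r.1 + 1) r.2.1) r.2.2

/-- `H` is a parity-check matrix of the code `C`. (Its rows need not be linearly independent.) -/
def IsParityCheck {F R N : Type*} [Field F] [Fintype N] (H : Matrix R N F)
    (C : Submodule F (N → F)) : Prop :=
  ∀ c : N → F, c ∈ C ↔ H.mulVec c = 0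

open Classical in
/-- The labels of the extra `q`-ary rows: those of the rows of `h_1` with numerators
`α^(f t / q + 1)`, `f = 1, …, q - 1`. It is used only when `q ∣ t`. -/
noncomputable def extraRows (q t m : ℕ) : Finset (RowIndex q t m) :=
  Finset.univ.filter fun r =>
    (r.1 : ℕ) = 0 ∧ ∃ f ∈ Finset.Icc 1 (q - 1), (r.2.1 : ℕ) = f * (t / q) + 1

/-- The matrix obtained from `H` by deleting the rows whose label lies in `D`. -/
def deleteRows {F R N : Type*} (H : Matrix R N F) (D : Finset R) :
    Matrix {r : R // r ∉ D} N F :=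
  H.submatrix (fun r => r.1) id

/-!
Write `N = α ^ (t + 1) + 1` and, for a row `r` over `K`, consider the moment `∑ α, c α • r α` of a
word `c`. A word is orthogonal to all `q`-ary rows of `r` exactly when its moment against `r`
vanishes, so every claim is about vanishing moments; the span statement follows by duality.

* Modulo `G₆ ^ J` the inverse of `x - α` is an explicit polynomial; the digits of its base-`G₆`
  expansion have as coefficients, up to sign, the numbers `α ^ a / N ^ j` with `a ≤ t` and
  `1 ≤ j ≤ J`. So `Γ(L₆, G₆ ^ J)` is cut out by the moments of `h_1, …, h_J` (`mem_Gamma6_iff`).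
* As `c` has entries in `F`, the moment of `r ^ q` is the `q`-th power of the moment of `r`
  (`moment_pow_card_pow`), so a row may be replaced by any conjugate. Since the Frobenius is onto
  modulo `G₆`, the moments of `h_q` vanish with those of the earlier blocks
  (`moment_hRow_card_eq_zero`).
* The norm `α ^ (t + 1) = N - 1` lies in `GF(t)`, so raising to the power `t` fixes `N`. Expanding
  powers of `N - 1` relates conjugate rows: this gives the redundancy of the rows
  `α ^ (f t / q + 1) / N` (`moment_extra_eq_zero`) and of the rows `α ^ (t + 1 - a) / N ^ j` with
  `1 ≤ a ≤ j` (`moment_conj_eq_zero`).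
* The rows `1 / N ^ j` have entries in `GF(t)` and impose only `l` conditions over `F` each.
  Counting the remaining conditions gives the dimension bound (`finrank_Gamma6_ge`,
  `card_keptRows`).
-/

/-! ### Moments of a word -/

/-- The moment `∑ α, c α • r α` of a word `c` over `F` against a row `r` with entries in `K`, as an
`F`-linear function of `c`. -/
noncomputable def moment (F : Type*) {K N : Type*} [Field F] [Field K] [Algebra F K] [Fintype N]
    (r : N → K) : (N → F) →ₗ[F] K :=
  Fintype.linearCombination F r

section Moment

variable {F K N : Type*} [Field F] [Field K] [Algebra F K] [Fintype N]

theorem moment_apply (r : N → K) (c : N → F) : moment F r c = ∑ α, c α • r α := rfl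

theorem moment_add (r s : N → K) (c : N → F) :
    moment F (r + s) c = moment F r c + moment F s c := by
  simp [moment_apply, Finset.sum_add_distrib]

theorem moment_smul (a : K) (r : N → K) (c : N → F) :
    moment F (a • r) c = a * moment F r c := by
  simp [moment_apply, Finset.mul_sum]

theorem moment_sum {ι : Type*} (s : Finset ι) (r : ι → N → K) (c : N → F) :
    moment F (∑ i ∈ s, r i) c = ∑ i ∈ s, moment F (r i) c := by
  simp only [moment_apply, Finset.sum_apply, Finset.smul_sum]
  exact Finset.sum_comm

/-- Since the entries of `c` lie in `F`, taking moments commutes with the Frobenius of `K / F`. -/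
theorem moment_pow_card_pow [Fintype F] (r : N → K) (c : N → F) (n : ℕ) :
    moment F (r ^ Fintype.card F ^ n) c = moment F r c ^ Fintype.card F ^ n := by
  induction n with
  | zero => simp
  | succ n ih =>
    rw [pow_succ, pow_mul, pow_mul, ← ih, ← FiniteField.frobeniusAlgHom_apply F K, moment_apply,
      moment_apply, map_sum]
    simp [map_smul, FiniteField.frobeniusAlgHom_apply]

theorem forall_qaryRow_dotProduct_eq_zero_iff {ι : Type*} (b : Module.Basis ι F K) (r : N → K)
    (c : N → F) : (∀ i, qaryRow b r i ⬝ᵥ c = 0) ↔ moment F r c = 0 := by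
  rw [← b.forall_coord_eq_zero_iff]
  refine forall_congr' fun i => ?_
  simp [moment_apply, qaryRow, dotProduct, mul_comm]

/-- A row lies in the span of a set of rows as soon as it is orthogonal to every word that is
orthogonal to the set. -/
theorem mem_span_of_forall_dotProduct_eq_zero (S : Set (N → F)) (v : N → F)
    (h : ∀ c : N → F, (∀ s ∈ S, s ⬝ᵥ c = 0) → v ⬝ᵥ c = 0) : v ∈ Submodule.span F S := by
  classical
  by_contra hv
  obtain ⟨f, hfv, hf⟩ := Submodule.exists_le_ker_of_notMem hv
  have key : ∀ w : N → F, f w = w ⬝ᵥ fun i => f (Pi.single i 1) := fun w => by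
    rw [LinearMap.pi_apply_eq_sum_univ f w]
    simp only [dotProduct, smul_eq_mul]
    refine Finset.sum_congr rfl fun i _ => ?_
    congr 2
    ext j
    simp [Pi.single_apply, eq_comm]
  refine hfv ((key v).trans (h _ fun s hs => ?_))
  rw [← key]
  exact hf (Submodule.subset_span hs)

end Moment

/-! ### The Goppa congruence in terms of moments -/

/-- Uniqueness of base-`G` expansions, in divisibility form: no degree bound on the sum is
needed. -/
theorem eq_zero_of_monic_pow_dvd_sum {R : Type*} [CommRing R] [IsDomain R] {G : R[X]}
    (hG : G.Monic) (J : ℕ) (p : ℕ → R[X]) (hp : ∀ i < J, (p i).degree < G.degree)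
    (h : G ^ J ∣ ∑ i ∈ Finset.range J, p i * G ^ i) : ∀ i < J, p i = 0 := by
  induction J generalizing p with
  | zero => simp
  | succ J ih =>
    have hsum : ∑ i ∈ Finset.range (J + 1), p i * G ^ i
        = G * ∑ i ∈ Finset.range J, p (i + 1) * G ^ i + p 0 := by
      rw [Finset.sum_range_succ', Finset.mul_sum, pow_zero, mul_one]
      congr 1
      exact Finset.sum_congr rfl fun i _ => by ring
    rw [hsum] at h
    have h0 : p 0 = 0 := by
      refine Polynomial.eq_zero_of_dvd_of_degree_lt ?_ (hp 0 (by omega))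
      exact (dvd_add_right (dvd_mul_right _ _)).1 ((dvd_pow_self G (by omega)).trans h)
    rw [h0, add_zero, pow_succ', mul_dvd_mul_iff_left hG.ne_zero] at h
    rintro (_ | i) hi
    · exact h0
    · exact ih (fun i => p (i + 1)) (fun i hi => hp _ (by omega)) h i (by omega)

theorem G6_natDegree {K : Type*} [Field K] (t : ℕ) : (G6 K t).natDegree = t + 1 :=
  natDegree_X_pow_add_C (n := t + 1) (r := (1 : K))

theorem G6_monic {K : Type*} [Field K] (t : ℕ) : (G6 K t).Monic :=
  monic_X_pow_add_C (1 : K) (Nat.succ_ne_zero t)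

theorem G6_degree {K : Type*} [Field K] (t : ℕ) : (G6 K t).degree = (t + 1 : ℕ) := by
  rw [degree_eq_natDegree (G6_monic t).ne_zero, G6_natDegree]

section Code

variable {F K : Type*} [Field F] [Field K] [Fintype K] [Algebra F K]

theorem mem_L6 {t : ℕ} {x : K} : x ∈ L6 K t ↔ x ^ (t + 1) + 1 ≠ 0 := by
  classical
  unfold L6
  rw [Finset.mem_filter]
  simp [G6]

theorem L6_ne_zero {t : ℕ} (α : L6 K t) : (α : K) ^ (t + 1) + 1 ≠ 0 :=
  mem_L6.1 α.2

/-- The negative of the inverse of `x - α` modulo `G₆ ^ J`, in base `G₆`: multiply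
`x ^ (t + 1) - α ^ (t + 1) = G₆ - N` and sum a geometric series in `G₆ / N`, where
`N = α ^ (t + 1) + 1`. -/
theorem X_sub_C_mul_sum (t J : ℕ) (α : L6 K t) :
    (X - C (α : K)) * ∑ i ∈ Finset.range J, (∑ b ∈ Finset.range (t + 1),
      C (hRow K t (i + 1) (t - b) α) * X ^ b) * G6 K t ^ i
      = C ((((α : K) ^ (t + 1) + 1) ^ J)⁻¹) * G6 K t ^ J - 1 := by
  set N : K := (α : K) ^ (t + 1) + 1 with hN
  have hN0 : N ≠ 0 := L6_ne_zero α
  have hi : ∀ i, (∑ b ∈ Finset.range (t + 1), C (hRow K t (i + 1) (t - b) α) * X ^ b)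
      = C ((N ^ (i + 1))⁻¹) * ∑ b ∈ Finset.range (t + 1), X ^ b * C (α : K) ^ (t + 1 - 1 - b) := by
    intro i
    rw [Finset.mul_sum]
    refine Finset.sum_congr rfl fun b _ => ?_
    rw [hRow, div_eq_mul_inv, C_mul, C_pow]
    simp only [Nat.add_sub_cancel]
    ring
  have hgeom : (X - C (α : K)) *
      ∑ b ∈ Finset.range (t + 1), X ^ b * C (α : K) ^ (t + 1 - 1 - b) = G6 K t - C N := by
    rw [mul_comm, (Commute.all _ _).geom_sum₂_mul, G6, hN]
    simp
  have hu : C N⁻¹ * C N = (1 : K[X]) := by rw [← C_mul, inv_mul_cancel₀ hN0, C_1]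
  calc _ = (∑ i ∈ Finset.range J, (C N⁻¹ * G6 K t) ^ i) * (C N⁻¹ * G6 K t - 1) := by
        rw [Finset.mul_sum, Finset.sum_mul]
        refine Finset.sum_congr rfl fun i _ => ?_
        rw [hi]
        calc _ = C ((N ^ (i + 1))⁻¹) * ((X - C (α : K)) *
              ∑ b ∈ Finset.range (t + 1), X ^ b * C (α : K) ^ (t + 1 - 1 - b)) * G6 K t ^ i := by
              ring
          _ = _ := by
            rw [hgeom, ← inv_pow, C_pow]
            linear_combination (-(C N⁻¹ ^ i * G6 K t ^ i)) * hu
    _ = _ := by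
        rw [geom_sum_mul, mul_pow, ← C_pow, inv_pow]

/-- A word belongs to `Γ(L₆, G₆ ^ J)` exactly when its moments against the rows of
`h_1, …, h_J` vanish: these moments are, up to sign, the base-`G₆` coefficients of
`∑ c_α / (x - α)` modulo `G₆ ^ J`. -/
theorem mem_Gamma6_iff (t J : ℕ) (c : L6 K t → F) :
    c ∈ Gamma6 F K t J ↔ ∀ i < J, ∀ a ≤ t, moment F (hRow K t (i + 1) a) c = 0 := by
  set G := G6 K t
  let p : ℕ → K[X] := fun i => ∑ b ∈ Finset.range (t + 1),
    C (moment F (hRow K t (i + 1) (t - b)) c) * X ^ b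
  have hinv : ∀ α : L6 K t, Ring.inverse (AdjoinRoot.root (G ^ J) - AdjoinRoot.of (G ^ J) (α : K))
      = -AdjoinRoot.mk (G ^ J) (∑ i ∈ Finset.range J, (∑ b ∈ Finset.range (t + 1),
          C (hRow K t (i + 1) (t - b) α) * X ^ b) * G ^ i) := by
    intro α
    have h1 := congrArg (AdjoinRoot.mk (G ^ J)) (X_sub_C_mul_sum t J α)
    rw [map_mul, map_sub, map_sub, map_mul, AdjoinRoot.mk_self, AdjoinRoot.mk_X, AdjoinRoot.mk_C,
      mul_zero, zero_sub, map_one] at h1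
    have h2 := neg_eq_iff_eq_neg.2 h1
    rw [← mul_neg] at h2
    have hu := IsUnit.of_mul_eq_one _ h2
    exact left_inv_eq_right_inv (Ring.inverse_mul_cancel _ hu) h2
  have hsum : ∑ α : L6 K t, AdjoinRoot.of (G ^ J) (algebraMap F K (c α)) *
      Ring.inverse (AdjoinRoot.root (G ^ J) - AdjoinRoot.of (G ^ J) (α : K))
      = -AdjoinRoot.mk (G ^ J) (∑ i ∈ Finset.range J, p i * G ^ i) := by
    simp only [hinv, mul_neg, Finset.sum_neg_distrib]
    simp only [← AdjoinRoot.mk_C, ← map_mul, ← map_sum]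
    congr 2
    simp only [Finset.mul_sum, p, moment_apply, map_sum, Finset.sum_mul, Algebra.smul_def, C_mul]
    rw [Finset.sum_comm]
    refine Finset.sum_congr rfl fun i _ => ?_
    rw [Finset.sum_comm]
    refine Finset.sum_congr rfl fun b _ => Finset.sum_congr rfl fun α _ => ?_
    ring
  have hdeg : ∀ i, (p i).degree < G.degree := fun i => by
    rw [G6_degree, degree_lt_iff_coeff_zero]
    intro m hm
    simp only [p, finsetSum_coeff, coeff_C_mul_X_pow]
    refine Finset.sum_eq_zero fun b hb => if_neg ?_
    have := Finset.mem_range.1 hb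
    omega
  have hcoeff : ∀ i, ∀ a ≤ t, (p i).coeff (t - a) = moment F (hRow K t (i + 1) a) c := by
    intro i a ha
    simp only [p, finsetSum_coeff, coeff_C_mul_X_pow]
    rw [Finset.sum_ite_eq, if_pos (Finset.mem_range.2 (by omega)), Nat.sub_sub_self ha]
  change (∑ α : L6 K t, AdjoinRoot.of (G ^ J) (algebraMap F K (c α)) *
      Ring.inverse (AdjoinRoot.root (G ^ J) - AdjoinRoot.of (G ^ J) (α : K))) = 0 ↔ _
  rw [hsum, neg_eq_zero, AdjoinRoot.mk_eq_zero]
  constructor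
  · intro h i hi a ha
    rw [← hcoeff i a ha, eq_zero_of_monic_pow_dvd_sum (G6_monic t) J p (fun i _ => hdeg i) h i hi,
      coeff_zero]
  · intro h
    have hp : ∀ i ∈ Finset.range J, p i * G ^ i = 0 := fun i hi => by
      have : p i = 0 := Finset.sum_eq_zero fun b _ => by
        rw [h i (Finset.mem_range.1 hi) _ (Nat.sub_le t b), C_0, zero_mul]
      rw [this, zero_mul]
    rw [Finset.sum_eq_zero hp]
    exact dvd_zero _

end Code

/-! ### Relations between the rows -/

section Relations

variable {F K : Type*} [Field F] [Field K] [Fintype K] [Algebra F K]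

/-- Expand `α ^ (m * (t + 1)) = (N - 1) ^ m`, with `N = α ^ (t + 1) + 1`, in powers of `N`. -/
theorem hRow_add_mul (t j a m : ℕ) (hm : m ≤ j) :
    hRow K t j (a + m * (t + 1)) = ∑ k ∈ Finset.range (m + 1),
      ((-1 : K) ^ (m - k) * (m.choose k : K)) • hRow K t (j - k) a := by
  ext α
  rw [Finset.sum_apply]
  have hN0 := L6_ne_zero α
  have hN : (α : K) ^ (t + 1) = ((α : K) ^ (t + 1) + 1) + (-1) := by ring
  simp only [hRow, Pi.smul_apply, smul_eq_mul]
  rw [pow_add, mul_comm m, pow_mul, hN, add_pow, Finset.mul_sum, Finset.sum_div, ← hN]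
  refine Finset.sum_congr rfl fun k hk => ?_
  have hk' : k ≤ j := (Nat.lt_succ_iff.1 (Finset.mem_range.1 hk)).trans hm
  rw [← Nat.sub_add_cancel hk', pow_add _ (j - k) k]
  simp only [Nat.add_sub_cancel]
  field_simp

theorem moment_hRow_add_mul (t j a m : ℕ) (hm : m ≤ j) (c : L6 K t → F)
    (h : ∀ k ∈ Finset.Icc 1 m, moment F (hRow K t (j - k) a) c = 0) :
    moment F (hRow K t j (a + m * (t + 1))) c = (-1) ^ m * moment F (hRow K t j a) c := by
  rw [hRow_add_mul t j a m hm, moment_sum, Finset.sum_eq_single 0]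
  · simp [moment_smul]
  · intro k hk hk0
    have := Finset.mem_range.1 hk
    rw [moment_smul, h k (Finset.mem_Icc.2 ⟨by omega, by omega⟩), mul_zero]
  · simp

/-- By base-`G₆` expansion, the rows of `h_1, …, h_J` span all rows `p(α) / N ^ J` with
`deg p < J (t + 1)`. -/
theorem moment_eval_div_eq_zero (t J : ℕ) (c : L6 K t → F)
    (h : ∀ i < J, ∀ a ≤ t, moment F (hRow K t (i + 1) a) c = 0)
    (p : K[X]) (hp : p.degree < (J * (t + 1) : ℕ)) :
    moment F (fun α : L6 K t => p.eval (α : K) / ((α : K) ^ (t + 1) + 1) ^ J) c = 0 := by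
  induction J generalizing p with
  | zero =>
    have : p = 0 := by simpa using hp
    simp [this, moment_apply]
  | succ J ih =>
    have hG := G6_monic (K := K) t
    have hrow : (fun α : L6 K t => p.eval (α : K) / ((α : K) ^ (t + 1) + 1) ^ (J + 1))
        = (∑ a ∈ Finset.range (t + 1), (p %ₘ G6 K t).coeff a • hRow K t (J + 1) a)
          + fun α : L6 K t => (p /ₘ G6 K t).eval (α : K) / ((α : K) ^ (t + 1) + 1) ^ J := by
      ext α
      have hN0 := L6_ne_zero α
      have hdeg : (p %ₘ G6 K t).natDegree < t + 1 := by
        have := natDegree_modByMonic_lt p hG fun h1 => by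
          simpa [h1] using G6_natDegree (K := K) t
        rwa [G6_natDegree] at this
      conv_lhs => rw [← modByMonic_add_div p (G6 K t)]
      rw [eval_add, eval_mul, eval_eq_sum_range' hdeg, Pi.add_apply, Finset.sum_apply]
      have hev : (G6 K t).eval (α : K) = (α : K) ^ (t + 1) + 1 := by simp [G6]
      rw [hev, add_div, Finset.sum_div]
      congr 1
      · refine Finset.sum_congr rfl fun a _ => ?_
        simp [hRow, mul_div_assoc]
      · rw [pow_succ' _ J, mul_div_mul_left _ _ hN0]
    rw [hrow, moment_add, moment_sum, ih (fun i hi => h i (by omega)), add_zero]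
    · refine Finset.sum_eq_zero fun a ha => ?_
      rw [moment_smul, h J (by omega) a (by have := Finset.mem_range.1 ha; omega), mul_zero]
    · rcases eq_or_ne (p /ₘ G6 K t) 0 with h0 | h0
      · rw [h0, degree_zero]
        exact WithBot.bot_lt_coe _
      · have hp0 : p ≠ 0 := fun hp0 => h0 (by rw [hp0, zero_divByMonic])
        rw [← natDegree_lt_iff_degree_lt hp0] at hp
        rw [← natDegree_lt_iff_degree_lt h0, natDegree_divByMonic p hG, G6_natDegree]
        have hle : t + 1 ≤ p.natDegree := by
          by_contra hlt
          refine h0 ((divByMonic_eq_zero_iff hG).2 ?_)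
          rw [G6_degree]
          exact degree_le_natDegree.trans_lt (by exact_mod_cast not_le.1 hlt)
        have : (J + 1) * (t + 1) = J * (t + 1) + (t + 1) := by ring
        omega

end Relations

/-! ### Frobenius conjugates of the rows -/

section Frobenius

variable {F K : Type*} [Field F] [Fintype F] [Field K] [Algebra F K]

theorem moment_pow_eq_zero_iff {N : Type*} [Fintype N] (n : ℕ) (r : N → K) (c : N → F) :
    moment F (r ^ Fintype.card F ^ n) c = 0 ↔ moment F r c = 0 := by
  rw [moment_pow_card_pow]
  exact pow_eq_zero_iff (pow_ne_zero _ Fintype.card_ne_zero)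

variable (F) in
theorem neg_one_pow_card_pow (R : Type*) [CommRing R] [Algebra F R] (l : ℕ) :
    (-1 : R) ^ Fintype.card F ^ l = -1 := by
  have h := FiniteField.pow_card_pow l (-1 : F)
  simpa using congrArg (algebraMap F R) h

variable (F) in
theorem add_pow_card_pow (R : Type*) [CommRing R] [Algebra F R] (l : ℕ) (x y : R) :
    (x + y) ^ Fintype.card F ^ l = x ^ Fintype.card F ^ l + y ^ Fintype.card F ^ l := by
  induction l with
  | zero => simp
  | succ l ih =>
    simp only [pow_succ, pow_mul, ih]
    simp only [← FiniteField.frobeniusAlgHom_apply F R, map_add]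

/-- Modulo `G₆` one has `x ^ (t + 1) = -1`, hence `x ^ (t ^ 2) = x`. -/
theorem root_pow_pow {l t : ℕ} (ht : t = Fintype.card F ^ l) :
    AdjoinRoot.root (G6 K t) ^ (t * t) = AdjoinRoot.root (G6 K t) := by
  set x := AdjoinRoot.root (G6 K t)
  have hx : x ^ (t + 1) = -1 := by
    have h := AdjoinRoot.mk_self (f := G6 K t)
    rw [G6, map_add, map_pow, map_one, ← G6, AdjoinRoot.mk_X] at h
    exact eq_neg_of_add_eq_zero_left h
  have hm : (-1 : AdjoinRoot (G6 K t)) ^ t = -1 := by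
    have h : (-1 : K) ^ t = -1 := by rw [ht]; exact neg_one_pow_card_pow F K l
    simpa using congrArg (AdjoinRoot.of (G6 K t)) h
  have h1 : x ^ (t * t) * x ^ (t + 1) = x * (x ^ (t + 1)) ^ t := by ring
  rw [hx, hm] at h1
  simpa using h1

variable [Fintype K]

variable (F) in
theorem pow_pow_eq_self {l t : ℕ} (hK : Module.finrank F K = 2 * l)
    (ht : t = Fintype.card F ^ l) (x : K) : (x ^ t) ^ t = x := by
  subst ht
  have h := FiniteField.pow_card x
  rwa [Module.card_eq_pow_finrank (K := F), hK, two_mul, pow_add, pow_mul] at h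

variable (F) in
/-- The values of `G₆` lie in the subfield `GF(t)`. -/
theorem norm_add_one_pow {l t : ℕ} (hK : Module.finrank F K = 2 * l)
    (ht : t = Fintype.card F ^ l) (x : K) :
    (x ^ (t + 1) + 1) ^ t = x ^ (t + 1) + 1 := by
  have h := add_pow_card_pow F K l (x ^ (t + 1)) 1
  rw [← ht] at h
  rw [h, one_pow, pow_succ, mul_pow, pow_pow_eq_self F hK ht, mul_comm]

variable (F) in
theorem hRow_pow_card_pow {l t : ℕ} (hK : Module.finrank F K = 2 * l)
    (ht : t = Fintype.card F ^ l) (j a : ℕ) :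
    hRow K t j a ^ t = hRow K t j (a * t) := by
  ext α
  have h := norm_add_one_pow F hK ht (α : K)
  simp only [hRow, Pi.pow_apply, div_pow]
  rw [← pow_mul, ← pow_mul _ j, mul_comm j, pow_mul _ t j, h]

/-- If the moments of `c` against `h_1, …, h_{q-1}` vanish, then so do those against `h_q`.
The Frobenius is onto modulo `G₆`, so `x ^ a = u ^ q + G₆ h` with `deg u ≤ t`; the contribution of
`u ^ q / G₆ ^ q` is the `q`-th power of a moment of `h_1`, and that of `h / G₆ ^ (q - 1)` is a
combination of moments of `h_1, …, h_{q-1}`. -/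
theorem moment_hRow_card_eq_zero {l t : ℕ} (hl : 1 ≤ l) (ht : t = Fintype.card F ^ l)
    (c : L6 K t → F)
    (h : ∀ i < Fintype.card F - 1, ∀ a ≤ t, moment F (hRow K t (i + 1) a) c = 0)
    (a : ℕ) (ha : a ≤ t) : moment F (hRow K t (Fintype.card F) a) c = 0 := by
  set q := Fintype.card F with hq
  have hq2 : 1 < q := Fintype.one_lt_card
  have hG := G6_monic (K := K) t
  obtain ⟨s, hs⟩ : q ∣ t * t := (ht ▸ dvd_pow_self q (by omega)).mul_right t
  set u : K[X] := X ^ (a * s) %ₘ G6 K t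
  have hudeg : u.natDegree ≤ t := by
    have := natDegree_modByMonic_lt (X ^ (a * s)) hG fun h1 => by
      simpa [h1] using G6_natDegree (K := K) t
    rw [G6_natDegree] at this
    exact Nat.lt_succ_iff.1 this
  have hdvd : G6 K t ∣ X ^ a - u ^ q := by
    have hu : AdjoinRoot.mk (G6 K t) u = AdjoinRoot.root (G6 K t) ^ (a * s) := by
      have h1 := congrArg (AdjoinRoot.mk (G6 K t)) (modByMonic_add_div (X ^ (a * s)) (G6 K t))
      rwa [map_add, map_mul, AdjoinRoot.mk_self, zero_mul, add_zero, map_pow,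
        AdjoinRoot.mk_X] at h1
    have hexp : a * s * q = t * t * a := by rw [hs]; ring
    rw [← AdjoinRoot.mk_eq_zero, map_sub, map_pow, map_pow, hu, AdjoinRoot.mk_X, ← pow_mul, hexp,
      pow_mul, root_pow_pow ht, sub_self]
  obtain ⟨g, hg⟩ := hdvd
  have hrow : hRow K t q a
      = (fun α : L6 K t => u.eval (α : K) / ((α : K) ^ (t + 1) + 1) ^ 1) ^ q ^ 1
        + fun α : L6 K t => g.eval (α : K) / ((α : K) ^ (t + 1) + 1) ^ (q - 1) := by
    ext α
    have hN0 := L6_ne_zero α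
    have hev := congrArg (eval (α : K)) hg
    have hG6 : (G6 K t).eval (α : K) = (α : K) ^ (t + 1) + 1 := by simp [G6]
    rw [eval_mul, hG6, eval_sub, eval_pow, eval_pow, eval_X, sub_eq_iff_eq_add'] at hev
    simp only [hRow, Pi.add_apply, Pi.pow_apply, pow_one, div_pow]
    rw [hev, add_div]
    congr 1
    nth_rw 1 [← Nat.sub_add_cancel hq2.le]
    rw [pow_succ' _ (q - 1), mul_div_mul_left _ _ hN0]
  rw [hrow, moment_add, (moment_pow_eq_zero_iff 1 _ c).2, zero_add]
  · refine moment_eval_div_eq_zero t (q - 1) c h g ?_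
    rcases eq_or_ne g 0 with h0 | h0
    · rw [h0, degree_zero]
      exact WithBot.bot_lt_coe _
    · rw [← natDegree_lt_iff_degree_lt h0]
      have h1 : (X ^ a - u ^ q).natDegree ≤ q * t := by
        refine (natDegree_sub_le _ _).trans (max_le ?_ ?_)
        · rw [natDegree_X_pow]
          exact ha.trans (Nat.le_mul_of_pos_left t (by omega))
        · exact natDegree_pow_le.trans (Nat.mul_le_mul_left q hudeg)
      rw [hg, hG.natDegree_mul' h0, G6_natDegree] at h1
      obtain ⟨r, hr⟩ : ∃ r, q = r + 2 := ⟨q - 2, by omega⟩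
      rw [hr] at h1 ⊢
      have h2 : (r + 2 - 1) * (t + 1) = (r + 2) * t + r + 1 - t := by
        rw [show (r + 2) * t + r + 1 = (r + 1) * (t + 1) + t by ring, Nat.add_sub_cancel]
        rfl
      omega
  · refine moment_eval_div_eq_zero t 1 c (fun i hi => h i (by omega)) u ?_
    refine degree_le_natDegree.trans_lt ?_
    exact_mod_cast (by omega : u.natDegree < 1 * (t + 1))

/-- The row of `h_1` with numerators `α ^ (f t / q + 1)` is redundant: its `q`-th power is
`(N - 1) ^ f α ^ (q - f) / N ^ q`, in which the term with denominator `N ^ q` is, up to sign, the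
`q t`-th power of the row of `h_1` with numerators `α ^ (t - f t / q)`. -/
theorem moment_extra_eq_zero {l t : ℕ} (hK : Module.finrank F K = 2 * l) (hl : 1 ≤ l)
    (ht : t = Fintype.card F ^ l) (c : L6 K t → F) (f : ℕ) (hf : f < Fintype.card F)
    (h1 : moment F (hRow K t 1 (t - f * (t / Fintype.card F))) c = 0)
    (h : ∀ j ∈ Finset.Icc (Fintype.card F - f) (Fintype.card F - 1),
      moment F (hRow K t j (Fintype.card F - f)) c = 0) :
    moment F (hRow K t 1 (f * (t / Fintype.card F) + 1)) c = 0 := by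
  have hst : t / Fintype.card F * Fintype.card F = t :=
    Nat.div_mul_cancel (ht ▸ dvd_pow_self _ (by omega))
  set q := Fintype.card F with hq
  set s := t / q
  have hpow : ∀ a, hRow K t 1 a ^ q = hRow K t q (a * q) := fun a => by
    ext α
    simp [hRow, div_pow, pow_mul]
  have htop : moment F (hRow K t q (q - f)) c = 0 := by
    have hrow : hRow K t 1 (t - f * s) ^ q ^ (1 + l) = hRow K t q (q - f) := by
      have hexp : (t - f * s) * q * t = t * t * (q - f) := by
        have : (t - f * s) * q = t * (q - f) := by
          rw [Nat.sub_mul, Nat.mul_sub, mul_assoc, hst, mul_comm t f]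
        rw [this]; ring
      rw [pow_add, pow_one, pow_mul, hpow, ← ht, hRow_pow_card_pow F hK ht, hexp]
      ext α
      have hα : (α : K) ^ (t * t) = α := by
        rw [pow_mul]; exact pow_pow_eq_self F hK ht _
      rw [hRow, hRow, pow_mul, hα]
    rw [← hrow]
    exact (moment_pow_eq_zero_iff _ _ c).2 h1
  have hexp : (f * s + 1) * q = (q - f) + f * (t + 1) := by
    have : (f * s + 1) * q = f * (s * q) + q := by ring
    rw [this, hst, mul_add]
    omega
  rw [← moment_pow_eq_zero_iff 1, pow_one, ← hq, hpow, hexp,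
    moment_hRow_add_mul t q (q - f) f hf.le c, htop, mul_zero]
  intro k hk
  have := Finset.mem_Icc.1 hk
  exact h _ (Finset.mem_Icc.2 ⟨by omega, by omega⟩)

/-- The row of `h_j` with numerators `α ^ (t + 1 - a)` is, up to sign and up to rows of earlier
blocks with the same numerators, the conjugate `(α ^ a / N ^ j) ^ t`. -/
theorem moment_conj_eq_zero {l t : ℕ} (hK : Module.finrank F K = 2 * l)
    (ht : t = Fintype.card F ^ l) (c : L6 K t → F) (j a : ℕ) (ha : 1 ≤ a) (haj : a ≤ j)
    (hat : a ≤ t) (h1 : moment F (hRow K t j a) c = 0)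
    (h : ∀ k ∈ Finset.Icc 1 (a - 1), moment F (hRow K t (j - k) (t + 1 - a)) c = 0) :
    moment F (hRow K t j (t + 1 - a)) c = 0 := by
  have hrow : hRow K t j a ^ Fintype.card F ^ l
      = hRow K t j ((t + 1 - a) + (a - 1) * (t + 1)) := by
    rw [← ht, hRow_pow_card_pow F hK ht]
    congr 1
    obtain ⟨b, rfl⟩ : ∃ b, a = b + 1 := ⟨a - 1, by omega⟩
    rw [Nat.add_sub_cancel, Nat.add_sub_add_right, add_mul, one_mul, mul_add, mul_one]
    omega
  have h2 := (moment_pow_eq_zero_iff l _ c).2 h1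
  rw [hrow, moment_hRow_add_mul t j _ (a - 1) (by omega) c h] at h2
  exact (mul_eq_zero.1 h2).resolve_left (pow_ne_zero _ (neg_ne_zero.2 one_ne_zero))

end Frobenius

/-! ### The parity-check matrices -/

section ParityCheck

variable {F K : Type*} [Field F] [Fintype F] [Field K] [Fintype K] [Algebra F K]

/-- `Γ(L₆, G₆ ^ (q - 1)) = Γ(L₆, G₆ ^ q)`, an instance of the classical fact for squarefree Goppa
polynomials. -/
theorem Gamma6_pred_eq {l t : ℕ} (hl : 1 ≤ l) (ht : t = Fintype.card F ^ l) :
    Gamma6 F K t (Fintype.card F - 1) = Gamma6 F K t (Fintype.card F) := by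
  ext c
  rw [mem_Gamma6_iff, mem_Gamma6_iff]
  constructor
  · intro h i hi a ha
    rcases Nat.lt_or_ge i (Fintype.card F - 1) with hi' | hi'
    · exact h i hi' a ha
    · have := moment_hRow_card_eq_zero hl ht c h a ha
      rwa [show Fintype.card F = i + 1 by omega] at this
  · exact fun h i hi => h i (by omega)

/-- The index pair of a block `h_{i+1}` and a numerator `α ^ a` labels one of the redundant rows
of `h_1`. -/
def IsExtra (q t i a : ℕ) : Prop := i = 0 ∧ ∃ f ∈ Finset.Icc 1 (q - 1), a = f * (t / q) + 1

/-- The relations for the redundant rows involve no redundant row on their right-hand sides, so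
all of these rows may be dropped together. -/
theorem moment_eq_zero_of_not_isExtra {l t : ℕ} (hK : Module.finrank F K = 2 * l) (hl : 1 ≤ l)
    (ht : t = Fintype.card F ^ l) (hqt : 2 * Fintype.card F < t + 3) (c : L6 K t → F)
    (h : ∀ i < Fintype.card F - 1, ∀ a ≤ t, ¬ IsExtra (Fintype.card F) t i a →
      moment F (hRow K t (i + 1) a) c = 0) :
    ∀ i < Fintype.card F - 1, ∀ a ≤ t, moment F (hRow K t (i + 1) a) c = 0 := by
  intro i hi a ha
  by_cases hE : IsExtra (Fintype.card F) t i a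
  swap
  · exact h i hi a ha hE
  obtain ⟨rfl, f, hf, rfl⟩ := hE
  rw [Finset.mem_Icc] at hf
  have hst : t / Fintype.card F * Fintype.card F = t :=
    Nat.div_mul_cancel (ht ▸ dvd_pow_self _ (by omega))
  have ht0 : 0 < t := by rw [ht]; exact pow_pos (by omega) _
  refine moment_extra_eq_zero hK hl ht c f (by omega) ?_ ?_
  · refine h 0 hi _ (Nat.sub_le _ _) ?_
    rintro ⟨-, g, hg, he⟩
    rw [Finset.mem_Icc] at hg
    generalize t / Fintype.card F = s at *
    generalize Fintype.card F = q at *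
    have hmul : (q - f) * s = g * s + 1 := by
      rw [← he, Nat.sub_mul, mul_comm q, hst]
    have hs1 : s = 1 := Nat.dvd_one.1 <|
      (Nat.dvd_add_right (dvd_mul_left s g)).1 (hmul ▸ dvd_mul_left s (q - f))
    subst hs1
    omega
  · intro j hj
    rw [Finset.mem_Icc] at hj
    have hle : Fintype.card F ≤ t := Nat.le_of_dvd ht0 (ht ▸ dvd_pow_self _ (by omega))
    have := h (j - 1) (by omega) (Fintype.card F - f) (by omega) ?_
    · rwa [Nat.sub_add_cancel (by omega)] at this
    · rintro ⟨hj0, g, hg, he⟩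
      rw [Finset.mem_Icc] at hg
      have hs : 0 < t / Fintype.card F := Nat.div_pos hle (by omega)
      have : 0 < g * (t / Fintype.card F) := Nat.mul_pos (by omega) hs
      omega

theorem mem_Gamma6_iff_of_not_isExtra {l t : ℕ} (hK : Module.finrank F K = 2 * l) (hl : 1 ≤ l)
    (ht : t = Fintype.card F ^ l) (hqt : 2 * Fintype.card F < t + 3) (c : L6 K t → F) :
    c ∈ Gamma6 F K t (Fintype.card F) ↔ ∀ i < Fintype.card F - 1, ∀ a ≤ t,
      ¬ IsExtra (Fintype.card F) t i a → moment F (hRow K t (i + 1) a) c = 0 := by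
  rw [← Gamma6_pred_eq hl ht, mem_Gamma6_iff]
  exact ⟨fun h i hi a ha _ => h i hi a ha,
    moment_eq_zero_of_not_isExtra hK hl ht hqt c⟩

theorem isParityCheck_H6 {l t : ℕ} (hl : 1 ≤ l) (ht : t = Fintype.card F ^ l) {m : ℕ}
    (b : Module.Basis (Fin m) F K) :
    IsParityCheck (H6 b (Fintype.card F) t) (Gamma6 F K t (Fintype.card F)) := by
  intro c
  rw [← Gamma6_pred_eq hl ht, mem_Gamma6_iff, funext_iff]
  simp only [← forall_qaryRow_dotProduct_eq_zero_iff b]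
  constructor
  · rintro h ⟨i, a, k⟩
    exact h i i.2 a (Nat.lt_succ_iff.1 a.2) k
  · intro h i hi a ha k
    exact h (⟨i, hi⟩, ⟨a, Nat.lt_succ_iff.2 ha⟩, k)

theorem mem_extraRows {q t m : ℕ} (r : RowIndex q t m) :
    r ∈ extraRows q t m ↔ IsExtra q t r.1 r.2.1 := by
  -- `extraRows` uses the classical decidability instance, so the instance is generalized.
  have h : ∀ (p : RowIndex q t m → Prop) (_ : DecidablePred p),
      r ∈ Finset.univ.filter p ↔ p r := fun p _ => by simp
  exact h _ _

theorem isParityCheck_deleteRows {l t : ℕ} (hK : Module.finrank F K = 2 * l) (hl : 1 ≤ l)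
    (ht : t = Fintype.card F ^ l) (hqt : 2 * Fintype.card F < t + 3) {m : ℕ}
    (b : Module.Basis (Fin m) F K) :
    IsParityCheck (deleteRows (H6 b (Fintype.card F) t) (extraRows (Fintype.card F) t m))
      (Gamma6 F K t (Fintype.card F)) := by
  intro c
  rw [mem_Gamma6_iff_of_not_isExtra hK hl ht hqt, funext_iff]
  simp only [← forall_qaryRow_dotProduct_eq_zero_iff b]
  constructor
  · rintro h ⟨⟨i, a, k⟩, hr⟩
    exact h i i.2 a (Nat.lt_succ_iff.1 a.2) (mt (mem_extraRows (i, a, k)).2 hr) k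
  · intro h i hi a ha hE k
    exact h ⟨(⟨i, hi⟩, ⟨a, Nat.lt_succ_iff.2 ha⟩, k), mt (mem_extraRows (⟨i, hi⟩, _, k)).1 hE⟩

theorem mul_add_self_le {q s f : ℕ} (hf : f ≤ q - 1) (hq : 0 < q) : f * s + s ≤ s * q := by
  rw [← Nat.succ_mul, mul_comm s]
  exact Nat.mul_le_mul_right s (by omega)

theorem card_extraRows {q t m : ℕ} (hq : 2 ≤ q) (ht : 0 < t) (hqt : q ∣ t) :
    (extraRows q t m).card = (q - 1) * m := by
  have hs : 0 < t / q := Nat.div_pos (Nat.le_of_dvd ht hqt) (by omega)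
  have hst := Nat.div_mul_cancel hqt
  have hcard : (Finset.Icc 1 (q - 1) ×ˢ (Finset.univ : Finset (Fin m))).card = (q - 1) * m := by
    simp
  rw [← hcard]
  symm
  refine Finset.card_bij (fun p hp => (⟨0, by omega⟩, ⟨p.1 * (t / q) + 1, ?_⟩, p.2)) ?_ ?_ ?_
  · have hf := (Finset.mem_Icc.1 (Finset.mem_product.1 hp).1).2
    have := mul_add_self_le (s := t / q) hf (by omega)
    omega
  · intro p hp
    exact (mem_extraRows _).2 ⟨rfl, p.1, (Finset.mem_product.1 hp).1, rfl⟩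
  · rintro ⟨f, k⟩ hfk ⟨g, k'⟩ hgk h
    simp only [Prod.mk.injEq, Fin.mk.injEq, true_and, Nat.add_right_cancel_iff] at h
    rw [Nat.mul_right_cancel hs h.1, h.2]
  · rintro ⟨i, a, k⟩ hr
    obtain ⟨hi, f, hf, ha⟩ := (mem_extraRows _).1 hr
    refine ⟨(f, k), Finset.mem_product.2 ⟨hf, Finset.mem_univ _⟩, ?_⟩
    ext
    · exact hi.symm
    · exact ha.symm
    · rfl

/-- The span statement for the redundant rows, by duality from the relation between moments. -/
theorem qaryRow_extra_mem_span {l t : ℕ} (hK : Module.finrank F K = 2 * l) (hl : 1 ≤ l)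
    (ht : t = Fintype.card F ^ l) {m : ℕ} (b : Module.Basis (Fin m) F K) (f : ℕ)
    (hf : f < Fintype.card F) (i : Fin m) :
    qaryRow b (hRow K t 1 (f * (t / Fintype.card F) + 1)) i ∈
      Submodule.span F
        (Set.range (qaryRow b (hRow K t 1 (t - f * (t / Fintype.card F)))) ∪
          ⋃ j ∈ Finset.Icc (Fintype.card F - f) (Fintype.card F - 1),
            Set.range (qaryRow b (hRow K t j (Fintype.card F - f)))) := by
  refine mem_span_of_forall_dotProduct_eq_zero _ _ fun c hc => ?_
  refine (forall_qaryRow_dotProduct_eq_zero_iff b _ c).2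
    (moment_extra_eq_zero hK hl ht c f hf ?_ fun j hj => ?_) i
  · exact (forall_qaryRow_dotProduct_eq_zero_iff b _ c).1 fun k => hc _ (Or.inl ⟨k, rfl⟩)
  · exact (forall_qaryRow_dotProduct_eq_zero_iff b _ c).1 fun k =>
      hc _ (Or.inr (Set.mem_biUnion hj ⟨k, rfl⟩))

end ParityCheck

/-! ### The dimension bound -/

section Dimension

variable {F K : Type*} [Field F] [Fintype F] [Field K] [Fintype K] [Algebra F K]

variable (F K) in
/-- The subfield `GF(q ^ l)` of `K`, the set of fixed points of `x ↦ x ^ (q ^ l)`, as an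
`F`-subspace. -/
def fixedSpace (l : ℕ) : Submodule F K where
  carrier := {x | x ^ Fintype.card F ^ l = x}
  zero_mem' := zero_pow (pow_ne_zero _ Fintype.card_ne_zero)
  add_mem' {x y} hx hy := (add_pow_card_pow F K l x y).trans (congrArg₂ _ hx hy)
  smul_mem' a x hx := by
    have h : (a • x) ^ Fintype.card F ^ l = a • x ^ Fintype.card F ^ l := by
      rw [_root_.smul_pow, FiniteField.pow_card_pow]
    exact h.trans (congrArg _ hx)

theorem finrank_fixedSpace_le {l : ℕ} (hl : 1 ≤ l) : Module.finrank F (fixedSpace F K l) ≤ l := by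
  classical
  set q := Fintype.card F with hq
  have hq1 : 1 < q := Fintype.one_lt_card
  have hne : (X ^ q ^ l - X : K[X]) ≠ 0 :=
    FiniteField.X_pow_card_pow_sub_X_ne_zero K (by omega) hq1
  have hcard : Nat.card (fixedSpace F K l) ≤ q ^ l := by
    have hsub : ((fixedSpace F K l : Submodule F K) : Set K)
        ⊆ ((X ^ q ^ l - X : K[X]).roots.toFinset : Set K) := by
      intro x hx
      have hx' : x ^ q ^ l = x := hx
      simp [mem_roots hne, hx']
    calc Nat.card (fixedSpace F K l) ≤ (X ^ q ^ l - X : K[X]).roots.toFinset.card := by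
          rw [← Set.ncard_coe_finset]
          exact Set.ncard_le_ncard hsub
      _ ≤ (X ^ q ^ l - X : K[X]).natDegree :=
          (Multiset.toFinset_card_le _).trans (card_roots' _)
      _ = q ^ l := FiniteField.X_pow_card_pow_sub_X_natDegree_eq K (by omega) hq1
  rw [Module.natCard_eq_pow_finrank (K := F), Nat.card_eq_fintype_card, ← hq] at hcard
  exact (Nat.pow_le_pow_iff_right hq1).1 hcard

theorem moment_hRow_zero_mem_fixedSpace {l t : ℕ} (hK : Module.finrank F K = 2 * l)
    (ht : t = Fintype.card F ^ l) (j : ℕ) (c : L6 K t → F) :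
    moment F (hRow K t j 0) c ∈ fixedSpace F K l := by
  change _ ^ _ = _
  rw [← moment_pow_card_pow, ← ht, hRow_pow_card_pow F hK ht, zero_mul]

theorem card_L6_ge {l t : ℕ} (hK : Module.finrank F K = 2 * l) (ht : t = Fintype.card F ^ l) :
    t * t ≤ (L6 K t).card + (t + 1) := by
  classical
  have hcard : Fintype.card K = t * t := by
    rw [Module.card_eq_pow_finrank (K := F), hK, two_mul, pow_add, ← ht]
  rw [← hcard, ← Finset.card_univ]
  have hsub : (Finset.univ : Finset K) ⊆ L6 K t ∪ (G6 K t).roots.toFinset := by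
    intro x _
    rw [Finset.mem_union, mem_L6, Multiset.mem_toFinset, mem_roots (G6_monic t).ne_zero]
    by_cases h : x ^ (t + 1) + 1 = 0
    · exact Or.inr (by simpa [G6] using h)
    · exact Or.inl h
  refine (Finset.card_le_card hsub).trans ((Finset.card_union_le _ _).trans ?_)
  refine Nat.add_le_add_left ((Multiset.toFinset_card_le _).trans ((card_roots' _).trans ?_)) _
  rw [G6_natDegree]

/-- Labels `(j, a)`, for the row of `h_j` with numerators `α ^ a`, `a ≥ 1`, of rows from which,
together with the rows with `a = 0`, all rows of `h_1, …, h_{q-1}` can be recovered. Left out are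
the redundant rows of `h_1` and the rows `(j, t + 1 - a)` with `1 ≤ a ≤ j`: modulo earlier blocks,
such a row is a conjugate of the row `(j, a)`. -/
def keptRows (q t : ℕ) : Finset (ℕ × ℕ) :=
  (Finset.Icc 1 (q - 1) ×ˢ Finset.Icc 1 t) \
    ((Finset.Icc 1 (q - 1)).image (fun f => (1, f * (t / q) + 1)) ∪
      ((Finset.Icc 1 (q - 1)).sigma fun j => Finset.Icc 1 j).image fun p => (p.1, t + 1 - p.2))

/-- The two families left out are disjoint because `t / q ≥ q > 1`; they have `q - 1` and
`1 + 2 + ⋯ + (q - 1)` members. -/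
theorem card_keptRows {q t : ℕ} (hq : 2 ≤ q) (ht : q * q ≤ t) (hqt : q ∣ t) :
    2 * (keptRows q t).card + (q - 1) * (q + 2) = 2 * ((q - 1) * t) := by
  have hst := Nat.div_mul_cancel hqt
  have hs : q ≤ t / q := (Nat.le_div_iff_mul_le (by omega)).2 ht
  have hqq : 2 * q ≤ t := (Nat.mul_le_mul_right q hq).trans ht
  have h1 : ((Finset.Icc 1 (q - 1)).image fun f => (1, f * (t / q) + 1)).card = q - 1 := by
    rw [Finset.card_image_of_injective, Nat.card_Icc, Nat.add_sub_cancel]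
    intro f g hfg
    simp only [Prod.mk.injEq, true_and, Nat.add_right_cancel_iff] at hfg
    exact Nat.mul_right_cancel (by omega) hfg
  have h2 : (((Finset.Icc 1 (q - 1)).sigma fun j => Finset.Icc 1 j).image
      fun p => (p.1, t + 1 - p.2)).card * 2 = q * (q - 1) := by
    rw [Finset.card_image_of_injOn, Finset.card_sigma, ← Finset.sum_range_id_mul_two]
    · congr 1
      simp only [Nat.card_Icc, Nat.add_sub_cancel]
      refine Finset.sum_subset (fun j hj => ?_) fun j hj hj' => ?_
      · rw [Finset.mem_Icc] at hj
        exact Finset.mem_range.2 (by omega)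
      · rw [Finset.mem_range] at hj
        rw [Finset.mem_Icc] at hj'
        omega
    · rintro ⟨j, a⟩ hp ⟨j', a'⟩ hp' h
      simp only [Finset.coe_sigma, Set.mem_sigma_iff, Finset.coe_Icc, Set.mem_Icc] at hp hp'
      simp only [Prod.mk.injEq] at h
      obtain ⟨rfl, h⟩ := h
      obtain rfl : a = a' := by omega
      rfl
  have hdisj : Disjoint ((Finset.Icc 1 (q - 1)).image fun f => (1, f * (t / q) + 1))
      (((Finset.Icc 1 (q - 1)).sigma fun j => Finset.Icc 1 j).image
        fun p => (p.1, t + 1 - p.2)) := by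
    rw [Finset.disjoint_left]
    intro x hx hx'
    obtain ⟨f, hf, rfl⟩ := Finset.mem_image.1 hx
    obtain ⟨⟨j, a⟩, hp, he⟩ := Finset.mem_image.1 hx'
    simp only [Finset.mem_sigma, Finset.mem_Icc] at hp hf
    simp only [Prod.mk.injEq] at he
    obtain ⟨rfl, he⟩ := he
    have h3 := mul_add_self_le (s := t / q) hf.2 (by omega)
    omega
  have hsub : (Finset.Icc 1 (q - 1)).image (fun f => (1, f * (t / q) + 1)) ∪
      ((Finset.Icc 1 (q - 1)).sigma fun j => Finset.Icc 1 j).image (fun p => (p.1, t + 1 - p.2))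
      ⊆ Finset.Icc 1 (q - 1) ×ˢ Finset.Icc 1 t := by
    intro x hx
    rcases Finset.mem_union.1 hx with hx | hx
    · obtain ⟨f, hf, rfl⟩ := Finset.mem_image.1 hx
      rw [Finset.mem_Icc] at hf
      have := mul_add_self_le (s := t / q) hf.2 (by omega)
      simp only [Finset.mem_product, Finset.mem_Icc]
      omega
    · obtain ⟨⟨j, a⟩, hp, rfl⟩ := Finset.mem_image.1 hx
      simp only [Finset.mem_sigma, Finset.mem_Icc] at hp
      simp only [Finset.mem_product, Finset.mem_Icc]
      omega
  have hle := Finset.card_le_card hsub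
  rw [keptRows, Finset.card_sdiff_of_subset hsub]
  rw [Finset.card_union_of_disjoint hdisj, h1, Finset.card_product, Nat.card_Icc, Nat.card_Icc,
    Nat.add_sub_cancel, Nat.add_sub_cancel] at hle ⊢
  have h6 : (q - 1) * (q + 2) = q * (q - 1) + 2 * (q - 1) := by ring
  omega

/-- The conjugates used to recover the rows `(j, t + 1 - a)`, `1 ≤ a ≤ j`, are never left out
themselves, because `a + j ≤ 2 (q - 1) ≤ t`. -/
theorem mem_Gamma6_of_keptRows {l t : ℕ} (hK : Module.finrank F K = 2 * l) (hl : 2 ≤ l)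
    (ht : t = Fintype.card F ^ l) (c : L6 K t → F)
    (h0 : ∀ i < Fintype.card F - 1, moment F (hRow K t (i + 1) 0) c = 0)
    (hk : ∀ p ∈ keptRows (Fintype.card F) t, moment F (hRow K t p.1 p.2) c = 0) :
    c ∈ Gamma6 F K t (Fintype.card F) := by
  have hq2 : 1 < Fintype.card F := Fintype.one_lt_card
  have hqq : Fintype.card F * Fintype.card F ≤ t := by
    rw [ht, ← pow_two]; exact Nat.pow_le_pow_right (by omega) hl
  have hdvd : Fintype.card F ∣ t := ht ▸ dvd_pow_self _ (by omega)
  have h2q : 2 * Fintype.card F ≤ t := (Nat.mul_le_mul_right _ hq2).trans hqq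
  rw [mem_Gamma6_iff_of_not_isExtra hK (by omega) ht (by omega)]
  set q := Fintype.card F
  have hst := Nat.div_mul_cancel hdvd
  have hs : q ≤ t / q := (Nat.le_div_iff_mul_le (by omega)).2 hqq
  have hlow : ∀ i < q - 1, ∀ a ≤ t, a + i < t → ¬ IsExtra q t i a →
      moment F (hRow K t (i + 1) a) c = 0 := by
    intro i hi a ha hai hE
    rcases Nat.eq_zero_or_pos a with rfl | ha0
    · exact h0 i hi
    · refine hk (i + 1, a) ?_
      simp only [keptRows, Finset.mem_sdiff, Finset.mem_product, Finset.mem_Icc, Finset.mem_union,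
        Finset.mem_image, Finset.mem_sigma, Prod.mk.injEq, Sigma.exists, not_or, not_exists]
      refine ⟨by omega, ?_, ?_⟩
      · rintro f ⟨hf, hi0, he⟩
        exact hE ⟨by omega, f, Finset.mem_Icc.2 hf, he.symm⟩
      · rintro j b ⟨hjb, hj, hb⟩
        omega
  intro i
  -- A row of high numerator degree is recovered from earlier blocks, hence the induction on them.
  induction i using Nat.strong_induction_on with
  | _ i ih =>
  intro hi a ha hE
  rcases Nat.lt_or_ge (a + i) t with hai | hai
  · exact hlow i hi a ha hai hE
  · obtain ⟨b, hb, rfl⟩ : ∃ b, b ≤ t ∧ a = t + 1 - b := ⟨t + 1 - a, by omega, by omega⟩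
    refine moment_conj_eq_zero hK ht c (i + 1) b (by omega) (by omega) hb ?_ ?_
    · refine hlow i hi b hb (by omega) ?_
      rintro ⟨hi0, f, hf, he⟩
      rw [Finset.mem_Icc] at hf
      have : 0 < f * (t / q) := Nat.mul_pos (by omega) (by omega)
      omega
    · intro k hk'
      rw [Finset.mem_Icc] at hk'
      rw [show i + 1 - k = (i - k) + 1 by omega]
      refine ih (i - k) (by omega) (by omega) _ ha ?_
      rintro ⟨hi0, f, hf, he⟩
      rw [Finset.mem_Icc] at hf
      have h3 := mul_add_self_le (s := t / q) hf.2 (by omega)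
      omega

/-- Each kept row imposes at most `2 l` conditions over `F`, and each row with constant numerators
only `l`, because its moments lie in `GF(q ^ l)`. -/
theorem finrank_Gamma6_ge {l t : ℕ} (hK : Module.finrank F K = 2 * l) (hl : 2 ≤ l)
    (ht : t = Fintype.card F ^ l) :
    (L6 K t).card ≤ Module.finrank F (Gamma6 F K t (Fintype.card F))
      + ((keptRows (Fintype.card F) t).card * (2 * l) + (Fintype.card F - 1) * l) := by
  set q := Fintype.card F
  let Ψ : (L6 K t → F) →ₗ[F] (keptRows q t → K) × (Fin (q - 1) → fixedSpace F K l) :=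
    LinearMap.prod (LinearMap.pi fun p => moment F (hRow K t p.1.1 p.1.2))
      (LinearMap.pi fun i => LinearMap.codRestrict _ (moment F (hRow K t (i + 1) 0))
        (moment_hRow_zero_mem_fixedSpace hK ht _))
  have hker : LinearMap.ker Ψ ≤ Gamma6 F K t q := by
    intro c hc
    have hc' : Ψ c = 0 := hc
    refine mem_Gamma6_of_keptRows hK hl ht c (fun i hi => ?_) fun p hp => ?_
    · exact congrArg Subtype.val (congrFun (congrArg Prod.snd hc') ⟨i, hi⟩)
    · exact congrFun (congrArg Prod.fst hc') ⟨p, hp⟩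
  have h1 := LinearMap.finrank_range_add_finrank_ker Ψ
  have h2 := Submodule.finrank_le (LinearMap.range Ψ)
  have h3 := Submodule.finrank_mono hker
  rw [Module.finrank_prod, Module.finrank_pi_fintype, Module.finrank_pi_fintype] at h2
  simp only [hK, Finset.sum_const, Finset.card_univ, Fintype.card_coe, Fintype.card_fin,
    smul_eq_mul] at h2
  rw [Module.finrank_fintype_fun_eq_card, Fintype.card_coe] at h1
  have h4 := Nat.mul_le_mul_left (q - 1)
    (finrank_fixedSpace_le (F := F) (K := K) (l := l) (by omega))
  omega

end Dimension

/-! ### The code `Γ₆` with Goppa polynomial `G₆ ^ q` -/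

theorem mainTheorem2 {F K : Type*} [Field F] [Fintype F] [Field K] [Fintype K] [Algebra F K]
    (q l t : ℕ) (hq : Fintype.card F = q) (hl : 1 ≤ l) (hK : Module.finrank F K = 2 * l)
    (ht : t = q ^ l) (hqt : 2 * q < t + 3) :
    (∀ b : Module.Basis (Fin (2 * l)) F K,
      IsParityCheck (H6 b q t) (Gamma6 F K t q) ∧
      (∀ f ∈ Finset.Icc 1 (q - 1), ∀ i : Fin (2 * l),
        qaryRow b (hRow K t 1 (f * (t / q) + 1)) i ∈
          Submodule.span F
            (Set.range (qaryRow b (hRow K t 1 (t - f * (t / q)))) ∪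
              ⋃ j ∈ Finset.Icc (q - f) (q - 1), Set.range (qaryRow b (hRow K t j (q - f))))) ∧
      (extraRows q t (2 * l)).card = (q - 1) * (2 * l) ∧
      IsParityCheck (deleteRows (H6 b q t) (extraRows q t (2 * l))) (Gamma6 F K t q)) ∧
    (t : ℝ) ^ 2 - t - 1 - 2 * l * (q - 1) * (t - 3 / 2 - (q - 2) / 2) ≤
      (Module.finrank F (Gamma6 F K t q) : ℝ) := by
  have hq2 : 1 < q := hq ▸ Fintype.one_lt_card
  have hdvd : q ∣ t := ht ▸ dvd_pow_self q (by omega)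
  have ht0 : 0 < t := by rw [ht]; exact pow_pos (by omega) _
  subst hq
  refine ⟨fun b => ⟨isParityCheck_H6 hl ht b, fun f hf i => ?_, card_extraRows hq2 ht0 hdvd,
    isParityCheck_deleteRows hK hl ht hqt b⟩, ?_⟩
  · rw [Finset.mem_Icc] at hf
    exact qaryRow_extra_mem_span hK hl ht b f (by omega) i
  set q := Fintype.card F
  rcases hl.eq_or_lt with rfl | hl2
  · -- Here `q = t = 2`, and the bound is `0`.
    rw [pow_one] at ht
    obtain rfl : t = 2 := by omega
    rw [← ht]
    norm_num
  · have h1 := finrank_Gamma6_ge hK hl2 ht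
    have h2 := card_L6_ge hK ht
    have hqq : q * q ≤ t := by
      rw [ht, ← pow_two]; exact Nat.pow_le_pow_right (by omega) hl2
    have h3 := card_keptRows hq2 hqq hdvd
    have h4 : ((q - 1 : ℕ) : ℝ) = (q : ℝ) - 1 := by rw [Nat.cast_sub hq2.le, Nat.cast_one]
    have h1' : ((L6 K t).card : ℝ) ≤ Module.finrank F (Gamma6 F K t q)
        + ((keptRows q t).card * (2 * l) + (q - 1) * l) := by
      rw [← h4]; exact_mod_cast h1
    have h2' : (t : ℝ) * t ≤ (L6 K t).card + (t + 1) := by exact_mod_cast h2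
    have h3' : 2 * ((keptRows q t).card : ℝ) + (q - 1) * (q + 2) = 2 * ((q - 1) * t) := by
      rw [← h4]; exact_mod_cast h3
    have h5 : (t : ℝ) ^ 2 - t - 1 - ((keptRows q t).card * (2 * l) + (q - 1) * l)
        ≤ Module.finrank F (Gamma6 F K t q) := by linarith
    refine le_trans (le_of_eq ?_) h5
    linear_combination (l : ℝ) * h3'
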